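/- A variety over a field is an integral separated scheme of finite type; it is called normal if its local rings are integrally closed domains. **Setting.** Let $B$ be a smooth proper curve over $\mathbb C$ with function field $K$. Let $A$ be an abelian variety over $K$, let $T$ be a smooth proper variety over $\mathbb C$ and put $T_K=T\times_{\mathbb C}K$. Let $X$ be a normal proper variety over $K$ with a finite surjective $K$-morphism $f\colon X\to A\times_K T_K$. An integral model over $B$ of a $K$-variety is an integral scheme, proper and flat over $B$, together with an identification of its generic fibre with the given variety. Let $\mathcal A$ be an integral model of $A$ that is smooth over $\mathbb C$, so that $\mathcal A\times_{\mathbb C}T$ has generic fibre $A\times_K T_K$ over $B$. Let $\mathcal X$ be a normal integral model of $X$ such that $f$ extends to a $B$-morphism $f\colon\mathcal X\to\mathcal A\times_{\mathbb C}T$. Let $\pi\colon\widetilde X\to X$ be a proper birational morphism from a smooth proper variety $\widetilde X$ over $K$, factored as $\widetilde X\xrightarrow{\pi_{\rm can}}X_{\rm can}\xrightarrow{\varpi}X$, where $X_{\rm can}$ is a normal variety, both morphisms are birational, and $\varpi$ is proper (for example, if $X$ is projective of general type: the canonical model $X_{\rm can}$ of $\widetilde X$, whenever $\pi$ factors in this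 way through it). Let $\widetilde{\mathcal X}$ be an integral model of $\widetilde X$ that is smooth over $\mathbb C$ and such that $\pi$ extends to a $B$-morphism $\pi\colon\widetilde{\mathcal X}\to\mathcal X$. **Divisors.** For a generically finite surjective morphism $g\colon V\to W$, its ramification divisor is $\sum_{E}\operatorname{length}_{\mathcal O_{V,E}}\big((\Omega_{V/W})_E\big)[E]$, the sum being over the prime divisors $E$ of $V$. Let $R$ be the ramification divisor of $f\colon X\to A\times_KT_K$ and let $D=f_*R$. Let $R_{\rm can}$ be the ramification divisor of $f\circ\varpi\colon X_{\rm can}\to A\times_KT_K$ and let $\widetilde R=\pi_{\rm can}^{-1}(\operatorname{Supp}R_{\rm can})$; this is the support of $\pi_{\rm can}^*R_{\rm can}$ whenever $R_{\rm can}$ is $\mathbb Q$-Cartier. Let $\mathcal R$, $\mathcal D$, $\widetilde{\mathcal R}$ be the Zariski closures of (the supports of) $R$, $D$, $\widetilde R$ in $\mathcal X$, $\mathcal A\times_{\mathbb C}T$, $\widetilde{\mathcal X}$ respectively, and let $\mathcal D_{\rm red}$ be the reduced induced closed subscheme of $\mathcal A\times_{\mathbb C}T$ on $\mathcal D$. Let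 $\widetilde{\mathcal R}_0\subseteq\widetilde{\mathcal R}$ be the union of all irreducible components of $\widetilde{\mathcal R}$ which dominate, under $\pi$, an irreducible component of $\mathcal R$. **Statement.** 1. For every closed point $x\in\widetilde{\mathcal R}_0$, the image of the tangent map ${\rm d}(f\circ\pi)_x\colon T_x\widetilde{\mathcal X}\to T_{(f\circ\pi)(x)}(\mathcal A\times_{\mathbb C}T)$ is contained in $T_{(f\circ\pi)(x)}(\mathcal D_{\rm red})$. 2. Let $\tilde x\in\widetilde X(K)$, viewed as a section $\tilde x\colon B\to\widetilde{\mathcal X}$, and view $(s,t)=(f\circ\pi)(\tilde x)\in A(K)\times T_K(K)$ as a section $(s,t)\colon B\to\mathcal A\times_{\mathbb C}T$. If $\tilde x(b)\in\widetilde{\mathcal R}_0$ for some $b\in B(\mathbb C)$, then $(s,t)$ is tangent to $\mathcal D_{\rm red}$ at $(s(b),t(b))$: the image of the tangent map ${\rm d}(s,t)\colon T_bB\to T_{(s(b),t(b))}(\mathcal A\times_{\mathbb C}T)$ at $b$ is contained in $T_{(s(b),t(b))}(\mathcal D_{\rm red})$. -/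

import Mathlib

open CategoryTheory Limits AlgebraicGeometry TopologicalSpace

noncomputable section

namespace FunctionFieldTangency

/-! ### Generalities on schemes -/

/-- A scheme is normal if all its local rings are integrally closed domains. -/
class IsNormalScheme (X : Scheme.{0}) : Prop where
  isDomain_stalk : ∀ x : X, IsDomain (X.presheaf.stalk x)
  isIntegrallyClosed_stalk : ∀ x : X, IsIntegrallyClosed (X.presheaf.stalk x)

/-- A birational morphism: it restricts to an isomorphism over a nonempty open subset of the
target (the schemes are varieties wherever this is used). -/
def IsBirationalMorphism {X Y : Scheme.{0}} (f : X ⟶ Y) : Prop :=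
  ∃ U : Y.Opens, (U : Set Y).Nonempty ∧ IsIso (f ∣_ U)

/-- The irreducible components of a subset `Z` of a topological space: the maximal irreducible
subsets of `Z`. -/
def componentsOf {X : Type*} [TopologicalSpace X] (Z : Set X) : Set (Set X) :=
  {W | Maximal (fun V => IsIrreducible V ∧ V ⊆ Z) W}

/-- The reduced induced closed subscheme `Z_red` on the closed subset `Z`. -/
def reducedSubscheme {Y : Scheme.{0}} (Z : Closeds Y) : Scheme.{0} :=
  (Scheme.IdealSheafData.vanishingIdeal Z).subscheme

/-- The closed immersion `Z_red ⟶ Y`. -/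
def reducedSubschemeι {Y : Scheme.{0}} (Z : Closeds Y) : reducedSubscheme Z ⟶ Y :=
  (Scheme.IdealSheafData.vanishingIdeal Z).subschemeι

/-! ### Tangent vectors of schemes over `ℂ` -/

/-- The inclusion of the closed point into `Spec ℂ[ε]`. -/
def dualNumberPoint : Spec (.of ℂ) ⟶ Spec (.of (DualNumber ℂ)) :=
  Spec.map (CommRingCat.ofHom (TrivSqZeroExt.fstHom ℂ ℂ ℂ).toRingHom)

/-- The structure morphism `Spec ℂ[ε] ⟶ Spec ℂ`. -/
def dualNumberStr : Spec (.of (DualNumber ℂ)) ⟶ Spec (.of ℂ) :=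
  Spec.map (CommRingCat.ofHom (algebraMap ℂ (DualNumber ℂ)))

/-- The tangent space at the point `x ∈ X(ℂ)` of a `ℂ`-scheme `p : X ⟶ Spec ℂ`, that is, the
set of `ℂ`-points over `x` of the tangent bundle `Spec (Sym Ω_X)`: these are the
`ℂ`-morphisms `Spec ℂ[ε] ⟶ X` which restrict to `x` on the closed point. -/
@[ext]
structure TangentVector {X : Scheme.{0}} (p : X ⟶ Spec (.of ℂ)) (x : Spec (.of ℂ) ⟶ X) where
  hom : Spec (.of (DualNumber ℂ)) ⟶ X
  hom_comp : hom ≫ p = dualNumberStr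
  point_comp : dualNumberPoint ≫ hom = x

/-- The tangent map `(df)_x : T_x X → T_{f(x)} Y` of a morphism `f` over `ℂ`. -/
def tangentMap {X Y : Scheme.{0}} {pX : X ⟶ Spec (.of ℂ)} {pY : Y ⟶ Spec (.of ℂ)}
    (f : X ⟶ Y) (hf : f ≫ pY = pX) (x : Spec (.of ℂ) ⟶ X) (v : TangentVector pX x) :
    TangentVector pY (x ≫ f) where
  hom := v.hom ≫ f
  hom_comp := by rw [Category.assoc, hf, v.hom_comp]
  point_comp := by rw [← Category.assoc, v.point_comp]

/-- For a closed subset `Z` of `Y`, the tangent space `T_y (Z_red)` viewed inside `T_y Y`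
through the closed immersion `Z_red ⟶ Y`. -/
def reducedTangentSpace {Y : Scheme.{0}} (pY : Y ⟶ Spec (.of ℂ)) (Z : Closeds Y)
    (y : Spec (.of ℂ) ⟶ Y) : Set (TangentVector pY y) :=
  {v | ∃ (z : Spec (.of ℂ) ⟶ reducedSubscheme Z)
      (w : TangentVector (reducedSubschemeι Z ≫ pY) z), w.hom ≫ reducedSubschemeι Z = v.hom}

/-- The topological point underlying `x ∈ X(ℂ)`. -/
def underlyingPoint {X : Scheme.{0}} (x : Spec (.of ℂ) ⟶ X) : X :=
  x (IsLocalRing.closedPoint ℂ)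

/-! ### Ramification and branch divisors

An effective Weil divisor on `X` is recorded by its multiplicities at all points of `X`, which
vanish away from the (generic points of prime divisors, i.e.) points of codimension one. -/

/-- The length of the stalk `(Ω_{X/Y})_x = Ω_{𝒪_{X,x} / 𝒪_{Y,f(x)}}` over `𝒪_{X,x}`. -/
def differentialLength {X Y : Scheme.{0}} (f : X ⟶ Y) (x : X) : ℕ∞ :=
  letI : Algebra (Y.presheaf.stalk (f x)) (X.presheaf.stalk x) := (f.stalkMap x).hom.toAlgebra
  Module.length (X.presheaf.stalk x) (Ω[X.presheaf.stalk x⁄Y.presheaf.stalk (f x)])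

open Classical in
/-- The ramification divisor `R(f) = ∑_D length (Ω_{X/Y})_D [D]`, the sum being over the prime
divisors `D` of `X`, each represented by its generic point. -/
def ramificationDivisor {X Y : Scheme.{0}} (f : X ⟶ Y) (x : X) : ℕ∞ :=
  if Order.coheight x = 1 then differentialLength f x else 0

/-- The push-forward `f_* E` of an effective divisor under a finite morphism: the multiplicity
of `f_* E` at `y` is `∑_{f(x) = y} [κ(x) : κ(y)] E(x)`, a finite sum. -/
def pushforwardDivisor {X Y : Scheme.{0}} (f : X ⟶ Y) (E : X → ℕ∞) (y : Y) : ℕ∞ :=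
  ∑ᶠ x : {x : X // f x = y}, (f.residueDegree x.1 : ℕ∞) * E x.1

/-- The support of an effective divisor. -/
def divisorSupport {X : Scheme.{0}} (E : X → ℕ∞) : Closeds X :=
  ⟨closure {x | E x ≠ 0}, isClosed_closure⟩

/-! ### Models over a curve -/

section Models

variable {B : Scheme.{0}} [IsIntegral B]

/-- The morphism `Spec K ⟶ B` from the generic point of `B`, where `K` is the function field. -/
abbrev genericMap (B : Scheme.{0}) [IsIntegral B] : Spec B.functionField ⟶ B :=
  B.fromSpecStalk (genericPoint B)

/-- `q : 𝒳 ⟶ B`, together with `j : X ⟶ 𝒳`, is an integral model over `B` of the `K`-scheme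
`pX : X ⟶ Spec K`: `𝒳` is integral, `q` is proper and flat, and `j` identifies `X` with the
generic fibre of `q`. -/
structure IsIntegralModel {X : Scheme.{0}} (pX : X ⟶ Spec B.functionField)
    {XX : Scheme.{0}} (q : XX ⟶ B) (j : X ⟶ XX) : Prop where
  isIntegral : IsIntegral XX
  isProper : IsProper q
  flat : Flat q
  isPullback : IsPullback j pX q (genericMap B)

/-- The Zariski closure in a model `j : X ⟶ 𝒳` of a closed subset of the generic fibre. -/
def zariskiClosure {X XX : Scheme.{0}} (j : X ⟶ XX) (Z : Closeds X) : Closeds XX :=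
  ⟨closure (j '' (Z : Set X)), isClosed_closure⟩

variable (pB : B ⟶ Spec (.of ℂ)) {T : Scheme.{0}} (pT : T ⟶ Spec (.of ℂ))

/-- The constant `K`-scheme `T_K = T ×_ℂ K`. -/
abbrev constScheme : Scheme.{0} := pullback pT (genericMap B ≫ pB)

/-- The structure morphism `T_K ⟶ Spec K`. -/
abbrev constSchemeStr : constScheme pB pT ⟶ Spec B.functionField :=
  pullback.snd pT (genericMap B ≫ pB)

variable {A : Scheme.{0}} (pA : A ⟶ Spec B.functionField)

/-- The `K`-scheme `A ×_K T_K`. -/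
abbrev prodConst : Scheme.{0} := pullback pA (constSchemeStr pB pT)

/-- The structure morphism `A ×_K T_K ⟶ Spec K`. -/
abbrev prodConstStr : prodConst pB pT pA ⟶ Spec B.functionField :=
  pullback.fst pA (constSchemeStr pB pT) ≫ pA

variable {AA : Scheme.{0}} (qA : AA ⟶ B)

/-- The `ℂ`-scheme `𝒜 ×_ℂ T`. -/
abbrev prodModel : Scheme.{0} := pullback (qA ≫ pB) pT

/-- The morphism `𝒜 ×_ℂ T ⟶ B`. -/
abbrev prodModelToBase : prodModel pB pT qA ⟶ B := pullback.fst (qA ≫ pB) pT ≫ qA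

/-- The structure morphism `𝒜 ×_ℂ T ⟶ Spec ℂ`. -/
abbrev prodModelStr : prodModel pB pT qA ⟶ Spec (.of ℂ) := prodModelToBase pB pT qA ≫ pB

variable {qA} in
/-- The inclusion `A ×_K T_K ⟶ 𝒜 ×_ℂ T` of the generic fibre of `𝒜 ×_ℂ T ⟶ B`, induced by the
inclusion `jA : A ⟶ 𝒜` of the generic fibre of `𝒜`. -/
def prodGenericIncl (jA : A ⟶ AA) (hA : IsIntegralModel pA qA jA) :
    prodConst pB pT pA ⟶ prodModel pB pT qA :=
  pullback.lift (pullback.fst pA (constSchemeStr pB pT) ≫ jA)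
    (pullback.snd pA (constSchemeStr pB pT) ≫ pullback.fst pT (genericMap B ≫ pB)) (by
      rw [Category.assoc, reassoc_of% hA.isPullback.w, Category.assoc, pullback.condition,
        pullback.condition_assoc])

end Models

/-- The part of `Zt ⊆ XXt` dominating `Z ⊆ XX` under `Π : XXt ⟶ XX`: the union of all
irreducible components of `Zt` which dominate an irreducible component of `Z`. -/
def dominatingPart {XXt XX : Scheme.{0}} (Pi : XXt ⟶ XX) (Zt : Closeds XXt) (Z : Closeds XX) :
    Set XXt :=
  ⋃₀ {W | W ∈ componentsOf (Zt : Set XXt) ∧ closure (Pi '' W) ∈ componentsOf (Z : Set XX)}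

end FunctionFieldTangency

end

/-! Ramification in codimension one forces vanishing to second order, and on a smooth source such
vanishing kills tangent vectors.

Let `ξ` be a codimension-one point of the normal variety `X` at which the finite morphism `f` is
ramified. The local ring at `ξ` is a discrete valuation ring, and the residue extension over `f ξ`
is finite in characteristic zero, hence separable. If the maximal ideal at `f ξ` generated the
maximal ideal at `ξ`, then `f` would be unramified there; so it lands in the square
(`map_maximalIdeal_stalk_le_sq`). Every function vanishing on the closure of `D` therefore pulls
back into the square of the maximal ideal at `ξ`.

Only finitely many such `ξ` exist (`finite_ramificationDivisor_ne_zero`), so the generic point `ζ`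
of a component of the dominating part maps to one of them, viewed in the model
(`exists_specializes_of_mem_dominatingPart`). Second-order vanishing passes from `ξ` to `ζ` along a
local homomorphism (`exists_lift_fromSpecStalk`, `germ_app_mem_sq`). On the smooth resolved model
the differential of the pulled-back function is then zero at `ζ`, hence at every specialization `x`
of `ζ`, so tangent vectors at `x` kill the function (`TangentVector.app_eq_zero`). Killing all
functions that vanish on a closed set means factoring through its reduced structure
(`mem_reducedTangentSpace`).

The assertion on sections follows by the chain rule, since the section `(s, t)` is the composite of
the section of the resolved model with the extended morphism. -/

namespace FunctionFieldTangency

/-! ### Commutative algebra -/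

section Algebra

open IsLocalRing

/-- If a discrete valuation ring is ramified over a local ring with residue field of characteristic
zero, then the maximal ideal of the latter generates an ideal contained in the square of the
maximal ideal. -/
theorem map_maximalIdeal_le_sq_of_not_formallyUnramified {O V : Type*} [CommRing O]
    [IsLocalRing O] [CommRing V] [IsDomain V] [IsDiscreteValuationRing V] [Algebra O V]
    [IsLocalHom (algebraMap O V)] [Algebra.EssFiniteType O V] [CharZero (ResidueField O)]
    [Algebra.IsAlgebraic (ResidueField O) (ResidueField V)]
    (h : ¬ Algebra.FormallyUnramified O V) :
    (maximalIdeal O).map (algebraMap O V) ≤ maximalIdeal V ^ 2 := by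
  obtain ⟨ϖ, hϖ⟩ := IsDiscreteValuationRing.exists_irreducible V
  by_cases h0 : (maximalIdeal O).map (algebraMap O V) = ⊥
  · simp [h0]
  obtain ⟨n, hn⟩ := IsDiscreteValuationRing.ideal_eq_span_pow_irreducible h0 hϖ
  rw [← Ideal.span_singleton_pow, ← (IsDiscreteValuationRing.irreducible_iff_uniformizer ϖ).mp hϖ]
    at hn
  rw [hn]
  -- The exponent is the ramification index: zero contradicts locality, and one gives an unramified
  -- extension because the residue extension is separable.
  match n, hn with
  | 0, hn =>
    have := (map_maximalIdeal_lt_top (algebraMap O V)).ne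
    simp_all
  | 1, hn =>
    rw [pow_one] at hn
    exact absurd (Algebra.FormallyUnramified.of_map_maximalIdeal hn) h
  | n + 2, _ => exact Ideal.pow_le_pow_right (by omega)

/-- Let `S` be formally smooth over `R`, and let `g` be an element of `S` lying in the square of
the maximal ideal of `S_p`. Then `g` is killed by the tangent vectors of `S` at the points of
the zero locus of `p`. -/
theorem map_eq_zero_of_mul_mem_sq {R S K : Type*} [CommRing R] [CommRing S] [CommRing K]
    [Algebra R S] [Algebra.FormallySmooth R S] (p : Ideal S) [p.IsPrime] {g s : S} (hs : s ∉ p)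
    (hg : s * g ∈ p ^ 2) (φ : S →+* DualNumber K)
    (hφ : ∀ r, (φ (algebraMap R S r)).snd = 0) (hp : ∀ a ∈ p, (φ a).fst = 0) :
    φ g = 0 := by
  have hgp : g ∈ p := (‹p.IsPrime›.mem_or_mem (Ideal.pow_le_self two_ne_zero hg)).resolve_left hs
  -- By formal smoothness the differentials are projective; `i` embeds them in a free module and so
  -- supplies coordinates for them.
  obtain ⟨i, hi⟩ := (inferInstance : Module.Projective S (Ω[S⁄R])).out
  have hsq : ∀ b ∈ p ^ 2, ∀ w, i (KaehlerDifferential.D R S b) w ∈ p := by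
    intro b hb w
    rw [pow_two] at hb
    induction hb using Submodule.mul_induction_on' with
    | mem_mul_mem m hm n hn =>
      simp only [Derivation.leibniz, map_add, map_smul, Finsupp.add_apply, Finsupp.smul_apply,
        smul_eq_mul]
      exact p.add_mem (p.mul_mem_right _ hm) (p.mul_mem_right _ hn)
    | add x _ y _ hx hy => simpa using p.add_mem hx hy
  -- In `d(s g) = s dg + g ds` the second term already has coordinates in `p`, and `s` can be
  -- cancelled modulo the prime `p`.
  have hdg : ∀ w, i (KaehlerDifferential.D R S g) w ∈ p := by
    intro w
    have := hsq _ hg w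
    simp only [Derivation.leibniz, map_add, map_smul, Finsupp.add_apply, Finsupp.smul_apply,
      smul_eq_mul] at this
    exact (‹p.IsPrime›.mem_or_mem
      ((p.add_mem_iff_left (p.mul_mem_right _ hgp)).mp this)).resolve_left hs
  let a : S →+* K := (TrivSqZeroExt.fstHom K K K).toRingHom.comp φ
  let : Module S K := Module.compHom K a
  let : Module R K := Module.compHom K (a.comp (algebraMap R S))
  have hsmul (x : S) (y : K) : x • y = (φ x).fst * y := rfl
  have : IsScalarTower R S K := ⟨fun r x y => by
    rw [Algebra.smul_def, mul_smul]; rfl⟩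
  -- The `ε`-coefficient of `φ` is a derivation over `R`, so it factors through the differentials
  -- and sees only the coordinates of `dg`, which vanish in `K`.
  let D : Derivation R S K := Derivation.mk'
    { toFun := fun x => (φ x).snd
      map_add' := by simp
      map_smul' := fun r x => by
        rw [Algebra.smul_def, map_mul, TrivSqZeroExt.snd_mul, hφ]
        simp
        rfl }
    (fun x y => by simp [hsmul, mul_comm])
  have hD : (φ g).snd = 0 := by
    change D g = 0
    rw [← Derivation.liftKaehlerDifferential_comp_D, ← hi (KaehlerDifferential.D R S g),
      Finsupp.linearCombination_apply, Finsupp.sum, map_sum]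
    refine Finset.sum_eq_zero fun w _ => ?_
    rw [map_smul, hsmul, hp _ (hdg w), zero_mul]
  exact TrivSqZeroExt.ext (hp g hgp) hD

/-- The residue field extension of a quasi-finite local homomorphism is finite. -/
theorem finite_residueField_of_quasiFinite {O V : Type*} [CommRing O] [IsLocalRing O] [CommRing V]
    [IsLocalRing V] [Algebra O V] [IsLocalHom (algebraMap O V)] [Algebra.QuasiFinite O V] :
    Module.Finite (ResidueField O) (ResidueField V) := by
  have : Algebra.QuasiFinite O (ResidueField V) := .trans O V _
  have : Algebra.QuasiFinite (ResidueField O) (ResidueField V) := .of_restrictScalars O _ _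
  exact .of_quasiFinite

end Algebra

/-! ### Ramification in codimension one -/

section Ramification

open IsLocalRing

variable {X Y : Scheme.{0}} (f : X ⟶ Y)

/-- The set of points at which a morphism is unramified is open. -/
theorem isOpen_formallyUnramified_stalkMap [LocallyOfFiniteType f] :
    IsOpen {x | (f.stalkMap x).hom.FormallyUnramified} := by
  refine isOpen_iff_forall_mem_open.mpr fun x hx ↦ ?_
  obtain ⟨_, ⟨U, hU, rfl⟩, hxU, -⟩ :=
    Y.isBasis_affineOpens.exists_subset_of_mem_open (Set.mem_univ (f x)) isOpen_univ
  obtain ⟨_, ⟨V, hV, rfl⟩, hxV, hVU⟩ :=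
    X.isBasis_affineOpens.exists_subset_of_mem_open hxU (U.2.preimage f.continuous)
  have hft := f.finiteType_appLE hU hV hVU
  algebraize [(f.appLE U V hVU).hom]
  -- Localizing the base at the image prime does not affect unramifiedness, so the stalkwise
  -- condition is the open condition on the affine chart.
  have key (y : X) (hy : y ∈ V) : (f.stalkMap y).hom.FormallyUnramified ↔
      hV.primeIdealOf ⟨y, hy⟩ ∈ Algebra.unramifiedLocus Γ(Y, U) Γ(X, V) := by
    let p := (hU.primeIdealOf ⟨f y, hVU hy⟩).asIdeal
    let q := (hV.primeIdealOf ⟨y, hy⟩).asIdeal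
    have : q.LiesOver p :=
      ⟨congr($(IsAffineOpen.comap_primeIdealOf_appLE U hU V hV hVU hy).1).symm⟩
    let := Localization.AtPrime.algebraOfLiesOver p q
    trans Algebra.FormallyUnramified (Localization.AtPrime p) (Localization.AtPrime q)
    · rw [← RingHom.formallyUnramified_algebraMap]
      exact RingHom.FormallyUnramified.respectsIso.arrow_mk_iso_iff
        (IsAffineOpen.arrowStalkMapIso f U hU V hV hVU hy)
    · refine ⟨fun _ => ?_, fun h => ?_⟩
      · exact Algebra.FormallyUnramified.comp Γ(Y, U) (Localization.AtPrime p) _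
      · have : Algebra.FormallyUnramified Γ(Y, U) (Localization.AtPrime q) := h
        exact Algebra.FormallyUnramified.of_restrictScalars Γ(Y, U) _ _
  refine ⟨Scheme.Opens.ι V '' (hV.isoSpec.hom ⁻¹' Algebra.unramifiedLocus Γ(Y, U) Γ(X, V)), ?_, ?_, ?_⟩
  · rintro _ ⟨y, hy, rfl⟩
    exact (key y.1 y.2).mpr hy
  · exact (Scheme.Opens.ι V).isOpenEmbedding.isOpenMap _
      (Algebra.isOpen_unramifiedLocus.preimage hV.isoSpec.hom.continuous)
  · exact ⟨⟨x, hxV⟩, (key x hxV).mp hx, rfl⟩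

theorem finite_residueField_stalkMap [IsFinite f] (x : X) :
    letI := (f.residueFieldMap x).hom.toAlgebra
    Module.Finite (Y.residueField (f x)) (X.residueField x) := by
  algebraize [(f.stalkMap x).hom]
  have : IsLocalHom (algebraMap (Y.presheaf.stalk (f x)) (X.presheaf.stalk x)) :=
    inferInstanceAs <| IsLocalHom (f.stalkMap x).hom
  have : Algebra.QuasiFinite (Y.presheaf.stalk (f x)) (X.presheaf.stalk x) :=
    f.quasiFiniteAt x
  have h := finite_residueField_of_quasiFinite (O := Y.presheaf.stalk (f x))
    (V := X.presheaf.stalk x)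
  suffices e : (f.residueFieldMap x).hom.toAlgebra =
      (inferInstance : Algebra (ResidueField (Y.presheaf.stalk (f x)))
        (ResidueField (X.presheaf.stalk x))) by
    rw [e]
    exact h
  refine Algebra.algebra_ext _ _ fun a ↦ ?_
  obtain ⟨a, rfl⟩ := IsLocalRing.residue_surjective (R := Y.presheaf.stalk (f x)) a
  rfl

theorem residueDegree_ne_zero [IsFinite f] (x : X) : f.residueDegree x ≠ 0 := by
  let := (f.residueFieldMap x).hom.toAlgebra
  have := finite_residueField_stalkMap f x
  exact Module.finrank_pos.ne'

theorem differentialLength_ne_zero_iff (x : X) :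
    differentialLength f x ≠ 0 ↔ ¬ (f.stalkMap x).hom.FormallyUnramified := by
  algebraize [(f.stalkMap x).hom]
  rw [differentialLength, Ne, Module.length_eq_zero_iff, ← Algebra.formallyUnramified_iff]
  rfl

/-- The local rings of a scheme over `ℂ` have residue fields of characteristic zero. -/
theorem charZero_residueField_stalk (p : Y ⟶ Spec (.of ℂ)) (y : Y) :
    CharZero (ResidueField (Y.presheaf.stalk y)) := by
  let φ : ℂ →+* ResidueField (Y.presheaf.stalk y) :=
    (residue _).comp ((Scheme.ΓSpecIso (.of ℂ)).inv ≫ p.appTop ≫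
      Y.presheaf.germ ⊤ y trivial).hom
  exact charZero_of_injective_ringHom φ.injective

variable {f}

/-- A finite morphism in characteristic zero is unramified at the generic point of its source. -/
theorem formallyUnramified_stalkMap_genericPoint [IsFinite f] [IsIntegral X]
    (p : Y ⟶ Spec (.of ℂ)) : (f.stalkMap (genericPoint X)).hom.FormallyUnramified := by
  set x := genericPoint X
  algebraize [(f.stalkMap x).hom]
  have : IsLocalHom (algebraMap (Y.presheaf.stalk (f x)) (X.presheaf.stalk x)) :=
    inferInstanceAs <| IsLocalHom (f.stalkMap x).hom
  have : Algebra.QuasiFinite (Y.presheaf.stalk (f x)) (X.presheaf.stalk x) :=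
    f.quasiFiniteAt x
  have := finite_residueField_of_quasiFinite (O := Y.presheaf.stalk (f x))
    (V := X.presheaf.stalk x)
  have := charZero_residueField_stalk p (f x)
  have : Algebra.EssFiniteType (Y.presheaf.stalk (f x)) (X.presheaf.stalk x) := by
    rw [← RingHom.essFiniteType_algebraMap, RingHom.algebraMap_toAlgebra]
    exact LocallyOfFiniteType.stalkMap f x
  have hfield : IsField (X.presheaf.stalk x) := Semifield.toIsField X.functionField
  refine Algebra.FormallyUnramified.of_map_maximalIdeal ?_
  rw [isField_iff_maximalIdeal_eq.mp hfield]
  refine le_bot_iff.mp ?_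
  rw [← isField_iff_maximalIdeal_eq.mp hfield]
  -- The stalk at the generic point is a field, so locality already makes the maximal ideal of the
  -- base map to zero, which is the whole maximal ideal upstairs.
  exact map_maximalIdeal_le _

/-- The points of codimension one of an integral noetherian scheme at which a finite morphism is
ramified are finite in number. -/
theorem finite_ramificationDivisor_ne_zero [IsFinite f] [IsIntegral X] [IsNoetherian X]
    (p : Y ⟶ Spec (.of ℂ)) : {x | ramificationDivisor f x ≠ 0}.Finite := by
  set Z := {x | (f.stalkMap x).hom.FormallyUnramified}ᶜ
  have hZc : IsClosed Z := (isOpen_formallyUnramified_stalkMap f).isClosed_compl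
  obtain ⟨S, hS, hcl, hirr, hSeq⟩ := NoetherianSpace.exists_finite_set_isClosed_irreducible hZc
  have hgen : genericPoint X ∉ Z := fun h => h (formallyUnramified_stalkMap_genericPoint p)
  refine (hS.biUnion (t := fun W => {x | closure {x} = W}) fun W _ =>
    Set.Subsingleton.finite fun x hx y hy => ?_).subset fun x hx => ?_
  · exact (inseparable_iff_closure_eq.mpr (Eq.trans hx (Eq.symm hy))).eq
  · have hx1 : Order.coheight x = 1 := by
      by_contra h
      exact hx (if_neg h)
    have hxZ : x ∈ Z := by
      rw [Set.mem_ofPred_eq, ramificationDivisor, if_pos hx1, differentialLength_ne_zero_iff] at hx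
      exact hx
    rw [hSeq] at hxZ
    obtain ⟨W, hW, hxW⟩ := hxZ
    obtain ⟨c, hc⟩ := QuasiSober.sober (hirr W hW) (hcl W hW)
    have hcx : c ⤳ x := hc.specializes hxW
    refine Set.mem_biUnion hW ?_
    -- Otherwise `x < c < genericPoint X` is a chain in the specialization order, contradicting
    -- codimension one; hence `x` is the generic point of one of the finitely many components.
    by_contra hne
    have hlt : x < c := lt_of_le_not_ge hcx fun h => hne (by
      rw [Set.mem_ofPred_eq, ← hc.def]
      exact inseparable_iff_closure_eq.mp (h.antisymm hcx))
    have hct : c < genericPoint X := lt_of_le_not_ge (genericPoint_specializes c) fun h => hgen (by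
      rw [hSeq]
      exact ⟨W, hW, h.mem_closed (hcl W hW) hc.mem⟩)
    have h1 := Order.coheight_add_one_le hlt
    have h2 := Order.coheight_add_one_le hct
    rw [hx1] at h1
    exact absurd ((add_le_add_left (le_add_self.trans h2) 1).trans h1) (by norm_num)

/-- A noetherian integrally closed local domain of dimension one is a local Dedekind domain that is
not a field. -/
theorem isDiscreteValuationRing_stalk [IsIntegral X] [IsNormalScheme X] [IsLocallyNoetherian X]
    {x : X} (hx : Order.coheight x = 1) : IsDiscreteValuationRing (X.presheaf.stalk x) := by
  have := IsNormalScheme.isIntegrallyClosed_stalk x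
  have := krullDimLE_of_coheight_le hx.le
  have hdim := ringKrullDim_stalk_eq_coheight x
  have hf : ¬ IsField (X.presheaf.stalk x) := fun h => by
    rw [ringKrullDim_eq_zero_of_isField h, hx] at hdim
    exact absurd hdim (by norm_num)
  have : Ring.DimensionLEOne (X.presheaf.stalk x) :=
    ⟨fun {I} hI hI' => Ring.krullDimLE_one_iff_of_noZeroDivisors.mp this I hI hI'⟩
  have hd : IsDedekindDomain (X.presheaf.stalk x) := { }
  exact ((IsDiscreteValuationRing.TFAE _ hf).out 2 0).mp hd

/-- Finiteness of `f` makes the residue extension algebraic, and the morphism to `Spec ℂ` provides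
characteristic zero, so the algebraic criterion for discrete valuation rings applies. -/
theorem map_maximalIdeal_stalk_le_sq [IsFinite f] [IsIntegral X] [IsNormalScheme X]
    [IsLocallyNoetherian X] (p : Y ⟶ Spec (.of ℂ)) {x : X} (hx : ramificationDivisor f x ≠ 0) :
    (maximalIdeal (Y.presheaf.stalk (f x))).map (f.stalkMap x).hom ≤
      maximalIdeal (X.presheaf.stalk x) ^ 2 := by
  have hx1 : Order.coheight x = 1 := by
    by_contra h
    exact hx (if_neg h)
  rw [ramificationDivisor, if_pos hx1, differentialLength_ne_zero_iff] at hx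
  have := isDiscreteValuationRing_stalk hx1
  algebraize [(f.stalkMap x).hom]
  have : IsLocalHom (algebraMap (Y.presheaf.stalk (f x)) (X.presheaf.stalk x)) :=
    inferInstanceAs <| IsLocalHom (f.stalkMap x).hom
  have : Algebra.QuasiFinite (Y.presheaf.stalk (f x)) (X.presheaf.stalk x) :=
    f.quasiFiniteAt x
  have := finite_residueField_of_quasiFinite (O := Y.presheaf.stalk (f x))
    (V := X.presheaf.stalk x)
  have := charZero_residueField_stalk p (f x)
  have : Algebra.EssFiniteType (Y.presheaf.stalk (f x)) (X.presheaf.stalk x) := by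
    rw [← RingHom.essFiniteType_algebraMap, RingHom.algebraMap_toAlgebra]
    exact LocallyOfFiniteType.stalkMap f x
  exact map_maximalIdeal_le_sq_of_not_formallyUnramified hx

/-- The push-forward of a divisor under a finite morphism contains in its support the image of
the support. -/
theorem pushforwardDivisor_ne_zero [IsFinite f] {E : X → ℕ∞} {x : X} (hx : E x ≠ 0) :
    pushforwardDivisor f E (f x) ≠ 0 := by
  have : Finite {x' : X // f x' = f x} := f.finite_preimage_singleton (f x)
  cases nonempty_fintype {x' : X // f x' = f x}
  rw [pushforwardDivisor, finsum_eq_sum_of_fintype]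
  intro h
  -- Multiplicities lie in `ℕ∞`, so nothing cancels and the term of `x` itself would have to vanish.
  have := (Finset.sum_eq_zero_iff.mp h) ⟨x, rfl⟩ (Finset.mem_univ _)
  simp [hx, residueDegree_ne_zero] at this

end Ramification

/-! ### Tangent vectors and vanishing to second order -/

section Tangent

open IsLocalRing

/-- The stalk depends on the image of the closed point, so an equality of morphisms cannot simply be
rewritten under a germ. -/
theorem germ_stalkClosedPointTo_congr {X : Scheme.{0}} {R : CommRingCat.{0}} [IsLocalRing R]
    {f g : Spec R ⟶ X} (h : f = g) (U : X.Opens) (hf : f (closedPoint R) ∈ U)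
    (hg : g (closedPoint R) ∈ U) (s : Γ(X, U)) :
    Scheme.stalkClosedPointTo f (X.presheaf.germ U _ hf s) =
      Scheme.stalkClosedPointTo g (X.presheaf.germ U _ hg s) := by
  subst h
  rfl

theorem stalkClosedPointTo_comp_germ {X Y : Scheme.{0}} {R : CommRingCat.{0}} [IsLocalRing R]
    (f : Spec R ⟶ X) (g : X ⟶ Y) (U : Y.Opens) (hf : g (f (closedPoint R)) ∈ U) (s : Γ(Y, U)) :
    Scheme.stalkClosedPointTo (f ≫ g) (Y.presheaf.germ U _ hf s) =
      Scheme.stalkClosedPointTo f (X.presheaf.germ (g ⁻¹ᵁ U) _ hf (g.app U s)) := by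
  rw [← Scheme.Hom.germ_stalkMap_apply, Scheme.stalkClosedPointTo_comp]
  rfl

theorem stalkClosedPointTo_fromSpecStalk_germ {X : Scheme.{0}} (x : X) (U : X.Opens)
    (hx : x ∈ U) (hU : X.fromSpecStalk x (closedPoint _) ∈ U) (s : Γ(X, U)) :
    Scheme.stalkClosedPointTo (X.fromSpecStalk x) (X.presheaf.germ U _ hU s) =
      X.presheaf.germ U x hx s := by
  have h : X.fromSpecStalk x = Spec.map (𝟙 (X.presheaf.stalk x)) ≫ X.fromSpecStalk x := by simp
  rw [germ_stalkClosedPointTo_congr h U hU (h ▸ hU)]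
  exact congr($(Scheme.germ_stalkClosedPointTo_Spec_fromSpecStalk
    (𝟙 (X.presheaf.stalk x)) U (h ▸ hU)) s)

/-- An open set containing the closed point of a local scheme is everything, so sections over the
preimage of `U` are just elements of `R`. -/
theorem app_eq_zero_of_stalkClosedPointTo_eq_zero {X : Scheme.{0}} {R : CommRingCat.{0}}
    [IsLocalRing R] (f : Spec R ⟶ X) (U : X.Opens) (hU : f (closedPoint R) ∈ U) (s : Γ(X, U))
    (h : Scheme.stalkClosedPointTo f (X.presheaf.germ U _ hU s) = 0) : f.app U s = 0 := by
  have e := congr($(Scheme.germ_stalkClosedPointTo f U hU) s)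
  rw [CommRingCat.comp_apply, h, CommRingCat.comp_apply] at e
  exact (map_eq_zero_iff _ (ConcreteCategory.bijective_of_isIso
    ((Spec R).presheaf.mapIso
      (eqToIso (Scheme.preimage_eq_top_of_closedPoint_mem f hU).symm).op ≪≫
      Scheme.ΓSpecIso R).hom).1).mp e.symm

variable {Z : Scheme.{0}} {pZ : Z ⟶ Spec (.of ℂ)} {x : Spec (.of ℂ) ⟶ Z}

theorem TangentVector.hom_closedPoint (v : TangentVector pZ x) :
    v.hom (closedPoint (DualNumber ℂ)) = underlyingPoint x := by
  have : IsLocalHom (TrivSqZeroExt.fstHom ℂ ℂ ℂ).toRingHom :=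
    ⟨fun a ha => TrivSqZeroExt.isUnit_iff_isUnit_fst.mpr ha⟩
  have h : dualNumberPoint (closedPoint ℂ) = closedPoint (DualNumber ℂ) :=
    Spec_closedPoint (f := CommRingCat.ofHom (TrivSqZeroExt.fstHom ℂ ℂ ℂ).toRingHom)
  have e : v.hom (dualNumberPoint (closedPoint ℂ)) = x (closedPoint ℂ) :=
    congr($(v.point_comp) (closedPoint ℂ))
  rw [h] at e
  exact e

/-- The coefficient of `ε` in the pull-back along a tangent vector vanishes on scalars. -/
theorem TangentVector.snd_stalkClosedPointTo_appLE (v : TangentVector pZ x) (V : Z.Opens)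
    (hV : v.hom (closedPoint (DualNumber ℂ)) ∈ V) (r : Γ(Spec (.of ℂ), ⊤)) :
    TrivSqZeroExt.snd (R := ℂ) (M := ℂ) (Scheme.stalkClosedPointTo v.hom
      (Z.presheaf.germ V _ hV (pZ.appLE ⊤ V le_top r))) = 0 := by
  have h : Scheme.stalkClosedPointTo v.hom
      (Z.presheaf.germ V _ hV (pZ.appLE ⊤ V le_top r)) =
      algebraMap ℂ (DualNumber ℂ) ((Scheme.ΓSpecIso (.of ℂ)).hom r) := by
    have hres : Z.presheaf.germ V _ hV (pZ.appLE ⊤ V le_top r) =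
        Z.presheaf.germ (pZ ⁻¹ᵁ ⊤) _ trivial (pZ.app ⊤ r) :=
      TopCat.Presheaf.germ_res_apply Z.presheaf (homOfLE (le_top : V ≤ pZ ⁻¹ᵁ ⊤)) _ hV _
    exact (congrArg (Scheme.stalkClosedPointTo v.hom) hres).trans
      ((stalkClosedPointTo_comp_germ v.hom pZ ⊤ trivial r).symm.trans
        ((germ_stalkClosedPointTo_congr v.hom_comp ⊤ trivial trivial r).trans
          congr($(Scheme.germ_stalkClosedPointTo_Spec
            (CommRingCat.ofHom (algebraMap ℂ (DualNumber ℂ)))) r)))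
  rw [h]
  exact TrivSqZeroExt.snd_inl _ _

/-- On a smooth scheme, a function which lies in the square of the maximal ideal at `ζ` is
killed by all the tangent vectors at the specializations of `ζ`. -/
theorem TangentVector.app_eq_zero [Smooth pZ] (v : TangentVector pZ x) {ζ : Z}
    (hζ : ζ ⤳ underlyingPoint x) (U : Z.Opens) (hxU : underlyingPoint x ∈ U) (g : Γ(Z, U))
    (hg : Z.presheaf.germ U ζ (hζ.mem_open U.2 hxU) g ∈ maximalIdeal (Z.presheaf.stalk ζ) ^ 2) :
    v.hom.app U g = 0 := by
  obtain ⟨_, ⟨V, hV, rfl⟩, hxV, hVU⟩ :=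
    Z.isBasis_affineOpens.exists_subset_of_mem_open hxU U.2
  have hpV : v.hom (closedPoint (DualNumber ℂ)) ∈ V := v.hom_closedPoint ▸ hxV
  have hpU : v.hom (closedPoint (DualNumber ℂ)) ∈ U := hVU hpV
  have hζV : ζ ∈ V := hζ.mem_open V.2 hxV
  have hζv : ζ ⤳ v.hom (closedPoint (DualNumber ℂ)) := v.hom_closedPoint ▸ hζ
  apply app_eq_zero_of_stalkClosedPointTo_eq_zero _ _ hpU
  have hres : V ≤ U := hVU
  rw [← TopCat.Presheaf.germ_res_apply Z.presheaf (homOfLE hres) _ hpV]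
  rw [← TopCat.Presheaf.germ_res_apply Z.presheaf (homOfLE hres) _ hζV] at hg
  generalize Z.presheaf.map (homOfLE hres).op g = g' at hg ⊢
  have hsm := pZ.smooth_appLE (isAffineOpen_top _) hV le_top
  algebraize [(pZ.appLE ⊤ V le_top).hom]
  let φ : Γ(Z, V) →+* DualNumber ℂ :=
    (Z.presheaf.germ V _ hpV ≫ Scheme.stalkClosedPointTo v.hom).hom
  let p : Ideal Γ(Z, V) := (hV.primeIdealOf ⟨ζ, hζV⟩).asIdeal
  let : Algebra Γ(Z, V) (Z.presheaf.stalk ζ) := (Z.presheaf.germ V ζ hζV).hom.toAlgebra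
  have : IsLocalization.AtPrime (Z.presheaf.stalk ζ) p := hV.isLocalization_stalk ⟨ζ, hζV⟩
  -- The square of the maximal ideal at `ζ` is the localization of `p ^ 2`; `s` is the cleared
  -- denominator.
  obtain ⟨s, hs, hsg⟩ : ∃ s ∉ p, s * g' ∈ p ^ 2 := by
    rw [← IsLocalization.AtPrime.map_eq_maximalIdeal p, ← Ideal.map_pow] at hg
    obtain ⟨s, hs, h⟩ := (IsLocalization.algebraMap_mem_map_algebraMap_iff p.primeCompl
      (Z.presheaf.stalk ζ) _ g').mp hg
    exact ⟨s, hs, h⟩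
  refine map_eq_zero_of_mul_mem_sq (R := Γ(Spec (.of ℂ), ⊤)) p hs hsg φ
    (v.snd_stalkClosedPointTo_appLE V hpV) fun a ha => ?_
  have ha' : ¬ IsUnit (Z.presheaf.germ V ζ hζV a) :=
    (IsLocalization.AtPrime.to_map_mem_maximal_iff (Z.presheaf.stalk ζ) p a).mpr ha
  -- If `a` did not vanish at the point `x`, its germ there would be a unit, hence also its germ at
  -- the generization `ζ`.
  by_contra h
  refine ha' ?_
  have h1 : IsUnit (Scheme.stalkClosedPointTo v.hom (Z.presheaf.germ V _ hpV a)) :=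
    TrivSqZeroExt.isUnit_iff_isUnit_fst.mpr (isUnit_iff_ne_zero.mpr h)
  have h2 : IsUnit (Z.presheaf.germ V _ hpV a) :=
    isUnit_of_map_unit (Scheme.stalkClosedPointTo v.hom).hom _ h1
  rw [← TopCat.Presheaf.germ_stalkSpecializes_apply Z.presheaf hpV hζv]
  exact h2.map (Z.presheaf.stalkSpecializes hζv).hom

/-- Every element of the maximal ideal squares to zero, so it lies in every prime. -/
theorem eq_closedPoint_dualNumber (z : PrimeSpectrum (DualNumber ℂ)) :
    z = closedPoint (DualNumber ℂ) := by
  refine PrimeSpectrum.ext ((le_maximalIdeal z.2.ne_top).antisymm fun a ha => ?_)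
  have h0 : a.fst = 0 := by
    by_contra h
    exact ha (TrivSqZeroExt.isUnit_iff_isUnit_fst.mpr (isUnit_iff_ne_zero.mpr h))
  refine z.2.mem_of_pow_mem 2 ?_
  have : a ^ 2 = 0 := by
    ext <;> simp [pow_two, h0]
  rw [this]
  exact zero_mem _

theorem section_eq_of_eq_bot {X : Scheme.{0}} {U : X.Opens} (hU : U = ⊥) (s t : Γ(X, U)) :
    s = t := by
  subst hU
  exact Subsingleton.elim _ _

/-- A tangent vector is tangent to a reduced subscheme `W` as soon as it kills the functions
which vanish on `W`. -/
theorem mem_reducedTangentSpace {Y : Scheme.{0}} {pY : Y ⟶ Spec (.of ℂ)} {W : Closeds Y}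
    {y : Spec (.of ℂ) ⟶ Y} (v : TangentVector pY y)
    (h : ∀ U : Y.affineOpens, underlyingPoint y ∈ U.1 →
      ∀ s ∈ (Scheme.IdealSheafData.vanishingIdeal W).ideal U, v.hom.app U s = 0) :
    v ∈ reducedTangentSpace pY W y := by
  have H : (reducedSubschemeι W).ker ≤ v.hom.ker := by
    refine (Scheme.IdealSheafData.ker_subschemeι _).le.trans ?_
    intro U s hs
    rw [Scheme.Hom.ker_apply, RingHom.mem_ker]
    by_cases hU : underlyingPoint y ∈ U.1
    · exact h U hU s hs
    · have hbot : v.hom ⁻¹ᵁ U.1 = ⊥ := by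
        refine eq_bot_iff.mpr fun z hz => (hU ?_).elim
        rw [← v.hom_closedPoint, ← eq_closedPoint_dualNumber z]
        exact hz
      exact section_eq_of_eq_bot hbot _ _
  have : IsClosedImmersion (reducedSubschemeι W) :=
    inferInstanceAs (IsClosedImmersion (Scheme.IdealSheafData.vanishingIdeal W).subschemeι)
  let l : Spec (.of (DualNumber ℂ)) ⟶ reducedSubscheme W :=
    IsClosedImmersion.lift (reducedSubschemeι W) v.hom H
  have hl : l ≫ reducedSubschemeι W = v.hom := IsClosedImmersion.lift_fac _ _ H
  exact ⟨dualNumberPoint ≫ l, ⟨l, by rw [reassoc_of% hl, v.hom_comp], rfl⟩, hl⟩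

/-- The germ of a function in the vanishing ideal of `W` at a point of `W` is not a unit. -/
theorem germ_mem_maximalIdeal {Y : Scheme.{0}} {W : Closeds Y} (U : Y.affineOpens)
    {s : Γ(Y, U)} (hs : s ∈ (Scheme.IdealSheafData.vanishingIdeal W).ideal U) {y : Y}
    (hyU : y ∈ U.1) (hy : y ∈ W) :
    Y.presheaf.germ U y hyU s ∈ maximalIdeal (Y.presheaf.stalk y) := by
  have h : y ∈ (Scheme.IdealSheafData.vanishingIdeal W).support := by
    rw [← SetLike.mem_coe, Scheme.IdealSheafData.coe_support_vanishingIdeal]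
    exact hy
  rw [Scheme.IdealSheafData.mem_support_iff_of_mem hyU, Scheme.mem_zeroLocus_iff] at h
  have := h s hs
  rwa [Scheme.mem_basicOpen _ _ _ hyU] at this

/-- Vanishing to second order is preserved by pull-back to the local scheme of a point. -/
theorem germ_app_mem_sq {X Y : Scheme.{0}} (g : Z ⟶ Y) (γ : X ⟶ Y) (ζ : Z) {ξ : X}
    (l : Spec (Z.presheaf.stalk ζ) ⟶ X) (hl : l ≫ γ = Z.fromSpecStalk ζ ≫ g)
    (hξ : l (closedPoint _) = ξ) (U : Y.Opens) (hU : γ ξ ∈ U) (hζ : g ζ ∈ U) (s : Γ(Y, U))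
    (hs : X.presheaf.germ (γ ⁻¹ᵁ U) ξ hU (γ.app U s) ∈ maximalIdeal (X.presheaf.stalk ξ) ^ 2) :
    Z.presheaf.germ (g ⁻¹ᵁ U) ζ hζ (g.app U s) ∈ maximalIdeal (Z.presheaf.stalk ζ) ^ 2 := by
  subst hξ
  have hζ' : g (Z.fromSpecStalk ζ (closedPoint _)) ∈ U := by
    rwa [Scheme.fromSpecStalk_closedPoint]
  -- The germ at `ζ` is the image of the germ at `ξ` under the local homomorphism defined by `l`,
  -- and local homomorphisms preserve squares of maximal ideals.
  have key := (stalkClosedPointTo_comp_germ _ g U hζ' s).symm.trans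
    ((germ_stalkClosedPointTo_congr hl U hU hζ' s).symm.trans
      (stalkClosedPointTo_comp_germ l γ U hU s))
  rw [← stalkClosedPointTo_fromSpecStalk_germ ζ _ hζ hζ', key]
  have := Ideal.mem_map_of_mem (Scheme.stalkClosedPointTo l).hom hs
  rw [Ideal.map_pow] at this
  exact Ideal.pow_right_mono (map_maximalIdeal_le _) 2 this

end Tangent

/-! ### Generic fibres and dominating components -/

section Dominating

open IsLocalRing

theorem genericMap_apply (B : Scheme.{0}) [IsIntegral B] (η : Spec B.functionField) :
    genericMap B η = genericPoint B := by
  rw [← Scheme.fromSpecStalk_closedPoint (x := genericPoint B)]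
  congr 1
  exact Subsingleton.elim (α := PrimeSpectrum B.functionField) _ _

theorem isDominant_genericMap (B : Scheme.{0}) [IsIntegral B] : IsDominant (genericMap B) :=
  ⟨dense_iff_closure_eq.mpr (Set.univ_subset_iff.mp ((genericPoint_closure B).ge.trans
    (closure_mono (Set.singleton_subset_iff.mpr
      ⟨closedPoint B.functionField, genericMap_apply B _⟩))))⟩

/-- The local scheme of a point of a model lying over a point of the generic fibre maps to the
generic fibre. -/
theorem exists_lift_fromSpecStalk {B : Scheme.{0}} [IsIntegral B] {X XX Z : Scheme.{0}}
    {pX : X ⟶ Spec B.functionField} {q : XX ⟶ B} {j : X ⟶ XX}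
    (h : IsPullback j pX q (genericMap B)) (P : Z ⟶ XX) {ζ : Z} {ξ : X} (hζ : P ζ = j ξ) :
    ∃ l : Spec (Z.presheaf.stalk ζ) ⟶ X, l ≫ j = Z.fromSpecStalk ζ ≫ P ∧
      l (closedPoint _) = ξ := by
  -- Being a base change of `Spec K ⟶ B`, the morphism `j` is injective on points; this identifies
  -- the image of the closed point as `ξ`.
  have hj : IsPreimmersion j := MorphismProperty.of_isPullback h.flip inferInstance
  have hgen : (P ≫ q) ζ = genericPoint B := by
    rw [Scheme.Hom.comp_apply, hζ, ← genericMap_apply B (pX ξ), ← Scheme.Hom.comp_apply, h.w, Scheme.Hom.comp_apply]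
  -- The image of `ζ` in `B` equals the generic point only propositionally; quantifying over `b`
  -- lets the equality be substituted in the type of the stalk.
  have transport : ∀ b : B, b = genericPoint B → ∀ (W : Scheme.{0})
      (t : W ⟶ Spec (B.presheaf.stalk b)),
      ∃ m : W ⟶ Spec B.functionField, m ≫ genericMap B = t ≫ B.fromSpecStalk b := by
    rintro _ rfl W t
    exact ⟨t, rfl⟩
  obtain ⟨m, hm⟩ := transport _ hgen _ (Spec.map ((P ≫ q).stalkMap ζ))
  rw [Scheme.SpecMap_stalkMap_fromSpecStalk] at hm
  have hfst := h.lift_fst (Z.fromSpecStalk ζ ≫ P) m (by rw [hm, Category.assoc])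
  refine ⟨_, hfst, hj.isEmbedding.injective ?_⟩
  refine (congr($hfst (closedPoint (Z.presheaf.stalk ζ)))).trans ?_
  rw [← hζ]
  exact congrArg P Scheme.fromSpecStalk_closedPoint

/-- A maximal irreducible subset of a closed subset is closed. -/
theorem isClosed_of_mem_componentsOf {X : Type*} [TopologicalSpace X] {Z W : Set X}
    (hZ : IsClosed Z) (hW : W ∈ componentsOf Z) : IsClosed W := by
  have hmax : Maximal (fun V => IsIrreducible V ∧ V ⊆ Z) W := hW
  have := hmax.eq_of_subset (t := closure W)
    ⟨hmax.prop.1.closure, closure_minimal hmax.prop.2 hZ⟩ subset_closure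
  rw [this]
  exact isClosed_closure

/-- If the closure of a point is an irreducible component of the closure of a finite set, then the
point lies in the set. -/
theorem mem_of_closure_singleton_mem_componentsOf {X : Type*} [TopologicalSpace X] [T0Space X]
    {S : Set X} (hS : S.Finite) {x : X} (hx : closure {x} ∈ componentsOf (closure S)) :
    x ∈ S := by
  have hmax : Maximal (fun V => IsIrreducible V ∧ V ⊆ closure S) (closure {x}) := hx
  have hxS : x ∈ closure S := hmax.prop.2 (subset_closure rfl)
  -- Closure commutes with finite unions, so `x` specializes from some `s` in `S`; maximality then
  -- forces equal closures, and the T0 axiom gives `x = s`.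
  rw [← S.biUnion_of_singleton, hS.closure_biUnion] at hxS
  obtain ⟨s, hs, hxs⟩ := Set.mem_iUnion₂.mp hxS
  have hle : closure {x} ⊆ closure {s} :=
    closure_minimal (Set.singleton_subset_iff.mpr hxs) isClosed_closure
  have := hmax.eq_of_subset ⟨isIrreducible_singleton.closure,
    closure_mono (Set.singleton_subset_iff.mpr hs)⟩ hle
  rwa [(inseparable_iff_closure_eq.mpr this).eq]

/-- The generic point of a component of the dominating part. -/
theorem exists_specializes_of_mem_dominatingPart {Z XX : Scheme.{0}} {P : Z ⟶ XX}
    {Zt : Closeds Z} {S : Set XX} (hS : S.Finite) {R : Closeds XX} (hR : (R : Set XX) = closure S)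
    {x : Z} (hx : x ∈ dominatingPart P Zt R) : ∃ ζ, ζ ⤳ x ∧ P ζ ∈ S := by
  obtain ⟨W, ⟨hW, hPW⟩, hxW⟩ := hx
  have hmax : Maximal (fun V => IsIrreducible V ∧ V ⊆ Zt) W := hW
  obtain ⟨ζ, hζ⟩ := QuasiSober.sober hmax.prop.1 (isClosed_of_mem_componentsOf Zt.isClosed hW)
  refine ⟨ζ, hζ.specializes hxW, mem_of_closure_singleton_mem_componentsOf hS ?_⟩
  rw [← hR]
  convert! hPW using 1
  rw [← hζ.def, ← Set.image_singleton, closure_image_closure P.continuous]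

end Dominating

end FunctionFieldTangency

open FunctionFieldTangency in
theorem corollary3p17
    -- the curve `B`, with function field `K`
    (B : Scheme.{0}) (pB : B ⟶ Spec (.of ℂ)) [IsIntegral B] [IsProper pB]
    [SmoothOfRelativeDimension 1 pB]
    -- the abelian variety `A` over `K`
    (A : Over (Spec B.functionField)) [GrpObj A] [IsProper A.hom] [GeometricallyIntegral A.hom]
    -- the variety `T` over `ℂ`
    (T : Scheme.{0}) (pT : T ⟶ Spec (.of ℂ)) [IsIntegral T] [IsProper pT] [Smooth pT]
    -- the variety `X` over `K` and the finite surjective morphism `f : X ⟶ A ×_K T_K`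
    (X : Scheme.{0}) (pX : X ⟶ Spec B.functionField) [IsIntegral X] [IsProper pX]
    [IsNormalScheme X]
    (f : X ⟶ prodConst pB pT A.hom) (hf : f ≫ prodConstStr pB pT A.hom = pX)
    [IsFinite f] [Surjective f]
    -- the smooth integral model `𝒜` of `A`
    (AA : Scheme.{0}) (qA : AA ⟶ B) (jA : A.left ⟶ AA) (hA : IsIntegralModel A.hom qA jA)
    [Smooth (qA ≫ pB)]
    -- the normal integral model `𝒳` of `X`, and the extension `F : 𝒳 ⟶ 𝒜 ×_ℂ T` of `f`
    (XX : Scheme.{0}) (qX : XX ⟶ B) (jX : X ⟶ XX) (hX : IsIntegralModel pX qX jX)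
    [IsNormalScheme XX]
    (F : XX ⟶ prodModel pB pT qA) (hF : F ≫ prodModelToBase pB pT qA = qX)
    (hFf : jX ≫ F = f ≫ prodGenericIncl pB pT A.hom jA hA)
    -- the resolution `π : X̃ ⟶ X`
    (Xt : Scheme.{0}) (pXt : Xt ⟶ Spec B.functionField) [IsIntegral Xt] [IsProper pXt]
    [Smooth pXt] (π : Xt ⟶ X) (hπ : π ≫ pX = pXt) (hπ_bir : IsBirationalMorphism π)
    -- any normal proper birational `X_can` through which `π` factors (for instance the canonical
    -- model of `X̃`), with `π_can : X̃ ⟶ X_can` and `ϖ : X_can ⟶ X`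
    (Xc : Scheme.{0}) [IsIntegral Xc] [IsNormalScheme Xc]
    (πc : Xt ⟶ Xc) (hπc_bir : IsBirationalMorphism πc)
    (ϖ : Xc ⟶ X) [IsProper ϖ] (hϖ_bir : IsBirationalMorphism ϖ) (hπϖ : πc ≫ ϖ = π)
    -- the smooth integral model `𝒳̃` of `X̃`, and the extension `Π : 𝒳̃ ⟶ 𝒳` of `π`
    (XXt : Scheme.{0}) (qXt : XXt ⟶ B) (jXt : Xt ⟶ XXt) (hXt : IsIntegralModel pXt qXt jXt)
    [Smooth (qXt ≫ pB)]
    (Pi : XXt ⟶ XX) (hPi : Pi ≫ qX = qXt) (hPiπ : jXt ≫ Pi = π ≫ jX)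
    -- `𝓡` and `𝒟`: the closures of the ramification divisor `R` of `f` and of `D = f_* R`
    (RR : Closeds XX) (hRR : RR = zariskiClosure jX (divisorSupport (ramificationDivisor f)))
    (DD : Closeds ↥(prodModel pB pT qA))
    (hDD : DD = zariskiClosure (prodGenericIncl pB pT A.hom jA hA)
      (divisorSupport (pushforwardDivisor f (ramificationDivisor f))))
    -- `𝓡̃`: the closure of the pull-back `R̃` to `X̃` of the ramification divisor of `f ∘ ϖ`; the
    -- pull-back of an effective divisor is supported on the preimage of its support
    (RRt : Closeds XXt)
    (hRRt : RRt = zariskiClosure jXt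
      ((divisorSupport (ramificationDivisor (ϖ ≫ f))).preimage πc.continuous)) :
    -- the image of the tangent map of `f ∘ π` at any closed point of `𝓡̃₀`
    (∀ (x : Spec (.of ℂ) ⟶ XXt), x ≫ qXt ≫ pB = 𝟙 _ →
      underlyingPoint x ∈ dominatingPart Pi RRt RR →
      Set.range (tangentMap (pX := qXt ≫ pB) (pY := prodModelStr pB pT qA) (Pi ≫ F)
          (by rw [← hPi, ← hF]; simp only [Category.assoc]) x) ⊆
        reducedTangentSpace (prodModelStr pB pT qA) DD (x ≫ Pi ≫ F)) ∧
    -- sections: `x̃ ∈ X̃(K)` extends to `xt : B ⟶ 𝒳̃`, and its image extends to `st = (s, t)`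
    (∀ (xK : Spec B.functionField ⟶ Xt), xK ≫ pXt = 𝟙 _ →
      ∀ (xt : B ⟶ XXt), xt ≫ qXt = 𝟙 B → genericMap B ≫ xt = xK ≫ jXt →
      ∀ (st : B ⟶ prodModel pB pT qA) (hst : st ≫ prodModelToBase pB pT qA = 𝟙 B),
      genericMap B ≫ st = (xK ≫ π ≫ f) ≫ prodGenericIncl pB pT A.hom jA hA →
      ∀ (b : Spec (.of ℂ) ⟶ B), b ≫ pB = 𝟙 _ →
      underlyingPoint (b ≫ xt) ∈ dominatingPart Pi RRt RR →
      Set.range (tangentMap (pX := pB) (pY := prodModelStr pB pT qA) st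
          (by rw [← Category.assoc, hst, Category.id_comp]) b) ⊆
        reducedTangentSpace (prodModelStr pB pT qA) DD (b ≫ st)) := by
  have hnoeth : IsNoetherian X :=
    { toIsLocallyNoetherian := LocallyOfFiniteType.isLocallyNoetherian pX
      toCompactSpace := by
        rw [← isCompact_univ_iff]
        exact QuasiCompact.isCompact_preimage (f := pX) Set.univ isOpen_univ isCompact_univ }
  -- A structure morphism to `Spec ℂ`, which serves to give the residue fields characteristic zero.
  set p := pullback.snd A.hom (constSchemeStr pB pT) ≫ pullback.fst pT (genericMap B ≫ pB) ≫ pT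
  set S := {ξ : X | ramificationDivisor f ξ ≠ 0}
  have hS : S.Finite := finite_ramificationDivisor_ne_zero p
  have hRS : (RR : Set XX) = closure (jX '' S) := by
    rw [hRR]
    exact closure_image_closure jX.continuous
  -- Stated through the underlying morphism `v.hom ≫ Pi ≫ F`, so that it serves both assertions
  -- although their base points are bracketed differently.
  have tangent : ∀ (x : Spec (.of ℂ) ⟶ XXt), underlyingPoint x ∈ dominatingPart Pi RRt RR →
      ∀ v : TangentVector (qXt ≫ pB) x,
        ∃ (z : Spec (.of ℂ) ⟶ reducedSubscheme DD)
          (w : TangentVector (reducedSubschemeι DD ≫ prodModelStr pB pT qA) z),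
          w.hom ≫ reducedSubschemeι DD = v.hom ≫ Pi ≫ F := by
    intro x hx v
    obtain ⟨ζ, hζx, ξ, hξ, hζ⟩ :=
      exists_specializes_of_mem_dominatingPart (hS.image jX) hRS hx
    obtain ⟨l, hl, hlξ⟩ := exists_lift_fromSpecStalk hX.isPullback Pi hζ.symm
    have hlγ : l ≫ f ≫ prodGenericIncl pB pT A.hom jA hA = XXt.fromSpecStalk ζ ≫ Pi ≫ F := by
      rw [← hFf, reassoc_of% hl]
    have hζξ : (Pi ≫ F) ζ = (f ≫ prodGenericIncl pB pT A.hom jA hA) ξ := by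
      rw [← hFf, Scheme.Hom.comp_apply, ← hζ, Scheme.Hom.comp_apply]
    have hDξ : (f ≫ prodGenericIncl pB pT A.hom jA hA) ξ ∈ DD := by
      rw [hDD]
      exact subset_closure ⟨f ξ, subset_closure (pushforwardDivisor_ne_zero hξ), rfl⟩
    let u : TangentVector (prodModelStr pB pT qA) (x ≫ Pi ≫ F) :=
      tangentMap (Pi ≫ F) (by rw [← hPi, ← hF]; simp only [Category.assoc]) x v
    refine mem_reducedTangentSpace u fun U hU s hs => ?_
    have hζU : (Pi ≫ F) ζ ∈ U.1 := (hζx.map (Pi ≫ F).continuous).mem_open U.1.2 hU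
    have hξU : (f ≫ prodGenericIncl pB pT A.hom jA hA) ξ ∈ U.1 := hζξ ▸ hζU
    have hsξ := germ_mem_maximalIdeal U hs hξU hDξ
    have key : X.presheaf.germ ((f ≫ prodGenericIncl pB pT A.hom jA hA) ⁻¹ᵁ U.1) ξ hξU
        ((f ≫ prodGenericIncl pB pT A.hom jA hA).app U.1 s) ∈
        IsLocalRing.maximalIdeal (X.presheaf.stalk ξ) ^ 2 := by
      -- The germ of `s` is a non-unit on `D`; it stays in the maximal ideal on passing to the
      -- generic fibre, and ramification of `f` then pushes it into the square.
      rw [← Scheme.Hom.germ_stalkMap_apply, Scheme.Hom.stalkMap_comp]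
      refine map_maximalIdeal_stalk_le_sq p hξ (Ideal.mem_map_of_mem _ ?_)
      exact IsLocalRing.map_maximalIdeal_le
        ((prodGenericIncl pB pT A.hom jA hA).stalkMap (f ξ)).hom (Ideal.mem_map_of_mem _ hsξ)
    have := v.app_eq_zero hζx ((Pi ≫ F) ⁻¹ᵁ U.1) hU ((Pi ≫ F).app U.1 s)
      (germ_app_mem_sq (Pi ≫ F) _ ζ l hlγ hlξ U.1 hξU hζU s key)
    change (v.hom ≫ Pi ≫ F).app U.1 s = 0
    rw [Scheme.Hom.comp_app]
    exact this
  refine ⟨?_, ?_⟩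
  · rintro x - hx _ ⟨v, rfl⟩
    exact tangent x hx v
  · rintro xK - xt hxt hxK st hst hstK b - hb _ ⟨v, rfl⟩
    have := hA.isProper
    have hsep : IsSeparated (prodModelToBase pB pT qA) := inferInstance
    have hdom : IsDominant (genericMap B) := isDominant_genericMap B
    -- Both sections of the separated `B`-scheme agree on the generic point, which is dense in the
    -- reduced scheme `B`.
    have hst' : st = xt ≫ Pi ≫ F := by
      refine ext_of_isDominant_of_isSeparated (prodModelToBase pB pT qA) ?_ (genericMap B) ?_
      · rw [hst, Category.assoc, Category.assoc, hF, hPi, hxt]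
      · rw [hstK, reassoc_of% hxK, reassoc_of% hPiπ, hFf]
        simp only [Category.assoc]
    subst hst'
    obtain ⟨z, w, hw⟩ := tangent (b ≫ xt) hb
      (tangentMap (pX := pB) xt (by rw [reassoc_of% hxt]) b v)
    exact ⟨z, w, hw.trans (Category.assoc _ _ _)⟩
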